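/- Let $1\le d<c$ be integers, let $H$ be a graph on $c$ vertices whose connected components are a complete graph $K_{c-d}$ and $d$ isolated vertices, and let $G$ be the graph obtained from $H$ by adding a whisker to each vertex, that is, for each vertex $v$ of $H$ a new vertex $v'$ adjacent only to $v$. Let $K$ be a field and let $S$ be the polynomial ring over $K$ whose variables are the vertices of $G$. For $k\ge 1$ let $I(G)^{[k]}\subset S$ be the $k$-th squarefree power of the edge ideal of $G$, i.e. the ideal generated by the monomials $x_M=\prod_{\{i,j\}\in M}x_ix_j$, where $M$ runs over the sets of $k$ pairwise disjoint edges of $G$. Then for every integer $k$ with $1\le k<c$ the ideal $I(G)^{[k]}$ is not linearly related. Here a homogeneous ideal generated in a single degree is called linearly related if its first syzygy module (the module of relations among the elements of a minimal system of homogeneous generators) is generated by linear relations, i.e. by relations whose coefficients are all linear forms or zero. -/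

import Mathlib

namespace SquarefreePower

open MvPolynomial

/-- The graph obtained from `H` by adding a whisker to each vertex: `Sum.inl v` is the old vertex
`v`, and `Sum.inr v` is a new vertex whose only neighbour is `Sum.inl v`. -/
def whiskerGraph {V : Type*} (H : SimpleGraph V) : SimpleGraph (V ⊕ V) where
  Adj
    | Sum.inl a, Sum.inl b => H.Adj a b
    | Sum.inl a, Sum.inr b => a = b
    | Sum.inr a, Sum.inl b => a = b
    | Sum.inr _, Sum.inr _ => False
  symm := ⟨by
    rintro (a | a) (b | b) h
    · exact SimpleGraph.Adj.symm h
    · exact Eq.symm h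
    · exact Eq.symm h
    · exact h⟩
  loopless := ⟨by
    rintro (a | a) h
    · exact H.loopless.irrefl a h
    · exact h⟩

/-- `M` is a `k`-matching of `G`: a set of `k` pairwise disjoint edges of `G`. -/
def IsKMatching {W : Type*} (G : SimpleGraph W) (k : ℕ) (M : Finset (Sym2 W)) : Prop :=
  (∀ e ∈ M, e ∈ G.edgeSet) ∧
    (∀ e ∈ M, ∀ e' ∈ M, e ≠ e' → ∀ v, v ∈ e → v ∉ e') ∧
    M.card = k

/-- The monomial `x_e = x_i x_j` of an edge `e = {i, j}`. -/
noncomputable def edgeMonomial (K : Type*) [Field K] {W : Type*} (e : Sym2 W) :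
    MvPolynomial W K :=
  (e.map X).mul

/-- The monomial `x_M`, the product of `x_e` over the edges `e` in `M`. -/
noncomputable def matchingMonomial (K : Type*) [Field K] {W : Type*} (M : Finset (Sym2 W)) :
    MvPolynomial W K :=
  ∏ e ∈ M, edgeMonomial K e

/-- The `k`-th squarefree power `I(G)^{[k]}` of the edge ideal of `G`: the ideal generated by the
monomials `x_M`, where `M` runs over the `k`-matchings of `G`. -/
noncomputable def squarefreePower (K : Type*) [Field K] {W : Type*} (G : SimpleGraph W) (k : ℕ) :
    Ideal (MvPolynomial W K) :=
  Ideal.span {p | ∃ M : Finset (Sym2 W), IsKMatching G k M ∧ p = matchingMonomial K M}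

/-- `f` is a minimal system of generators of `I` consisting of homogeneous polynomials, all of
the same degree `d`. -/
structure IsMinimalHomogeneousGenerators {K : Type*} [Field K] {W : Type*}
    (I : Ideal (MvPolynomial W K)) (d : ℕ) {m : ℕ} (f : Fin m → MvPolynomial W K) : Prop where
  homogeneous : ∀ i, (f i).IsHomogeneous d
  span_eq : Ideal.span (Set.range f) = I
  minimal : ∀ i, f i ∉ Ideal.span (f '' {i}ᶜ)

/-- The first syzygy module of the family `f`: all `g` with `∑ i, g i * f i = 0`. -/
noncomputable def syzygies {K : Type*} [Field K] {W : Type*} {m : ℕ}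
    (f : Fin m → MvPolynomial W K) : Submodule (MvPolynomial W K) (Fin m → MvPolynomial W K) :=
  LinearMap.ker (Fintype.linearCombination (MvPolynomial W K) f)

/-- A homogeneous ideal `I` generated in a single degree is linearly related if its first syzygy
module, formed from a minimal system of homogeneous generators, is generated by linear relations,
that is, by syzygies all of whose entries are linear forms (possibly zero). The syzygy modules of
two such systems of generators differ by an invertible matrix with entries in `K`, so the choice
of the system does not matter. -/
def IsLinearlyRelated {K : Type*} [Field K] {W : Type*} (I : Ideal (MvPolynomial W K)) : Prop :=
  ∃ (d m : ℕ) (f : Fin m → MvPolynomial W K), IsMinimalHomogeneousGenerators I d f ∧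
    Submodule.span (MvPolynomial W K) {g | g ∈ syzygies f ∧ ∀ i, (g i).IsHomogeneous 1} =
      syzygies f

end SquarefreePower

namespace SquarefreePower

open MvPolynomial

/-! ### Degree arguments for polynomials -/

section Homogeneous

variable {K W : Type*} [Field K]

/-! An isolated vertex of `H` gives, with its whisker, an edge `{a, b}` of `G` disjoint from all
others. So each `x_M` is either divisible by `x_a x_b` or free of both variables, and for `1 ≤ k <
c` both kinds occur. Setting `x_a = 0` keeps the second kind and kills the first. A linear syzygy
stays a syzygy after this: the new sum is divisible by `x_a x_b`, yet a linear form times a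
polynomial free of `x_a`, `x_b` has no such monomial. The Koszul syzygy between one generator `u` of
the first kind and one `v` of the second does not survive, as its sum becomes `-u v`. Hence linear
syzygies cannot generate (`not_isLinearlyRelated_span`). -/

theorem homogeneousComponent_mul_mem_span {S : Set (MvPolynomial W K)}
    {D : ℕ} {s : MvPolynomial W K} (hs : s ∈ S) (hD : s.IsHomogeneous D) (q : MvPolynomial W K) :
    homogeneousComponent D (q * s) ∈ Submodule.span K S := by
  induction q using MvPolynomial.induction_on' with
  | monomial m r =>
    have hmem := (isHomogeneous_monomial (d := m) r rfl).mul hD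
    rw [homogeneousComponent_of_mem ((mem_homogeneousSubmodule _ _).2 hmem)]
    split_ifs with h
    · have hm : m = 0 := (Finsupp.degree_eq_zero_iff m).1 (by omega)
      subst hm
      rw [← C_apply, ← smul_eq_C_mul]
      exact Submodule.smul_mem _ _ (Submodule.subset_span hs)
    · exact Submodule.zero_mem _
  | add p q hp hq =>
    rw [add_mul, map_add]
    exact Submodule.add_mem _ hp hq

theorem mem_span_of_isHomogeneous {S : Set (MvPolynomial W K)} {D : ℕ}
    (hS : ∀ s ∈ S, s.IsHomogeneous D) {p : MvPolynomial W K} (hp : p ∈ Ideal.span S)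
    (hD : p.IsHomogeneous D) : p ∈ Submodule.span K S := by
  -- The extra factor `q` absorbs ring scalars in the span induction.
  have key : ∀ q : MvPolynomial W K, homogeneousComponent D (q * p) ∈ Submodule.span K S := by
    refine Submodule.span_induction (p := fun x _ ↦ ∀ q : MvPolynomial W K,
      homogeneousComponent D (q * x) ∈ Submodule.span K S) ?_ ?_ ?_ ?_ hp
    · exact fun s hs q ↦ homogeneousComponent_mul_mem_span hs (hS s hs) q
    · simp
    · intro x y _ _ hx hy q
      rw [mul_add, map_add]
      exact Submodule.add_mem _ (hx q) (hy q)
    · intro r x _ hx q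
      rw [smul_eq_mul, ← mul_assoc]
      exact hx _
  have := key 1
  rwa [one_mul, homogeneousComponent_of_mem ((mem_homogeneousSubmodule _ _).2 hD), if_pos rfl]
    at this

theorem homogeneousComponent_mul_eq_zero {D e : ℕ} (he : e < D) {s : MvPolynomial W K}
    (hs : s.IsHomogeneous D) (q : MvPolynomial W K) : homogeneousComponent e (q * s) = 0 := by
  induction q using MvPolynomial.induction_on' with
  | monomial m r =>
    have hmem := (isHomogeneous_monomial (d := m) r rfl).mul hs
    rw [homogeneousComponent_of_mem ((mem_homogeneousSubmodule _ _).2 hmem), if_neg (by omega)]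
  | add p q hp hq => rw [add_mul, map_add, hp, hq, add_zero]

theorem le_of_isHomogeneous_of_mem_span {S : Set (MvPolynomial W K)} {D e : ℕ}
    (hS : ∀ s ∈ S, s.IsHomogeneous D) {p : MvPolynomial W K} (hp : p ∈ Ideal.span S)
    (he : p.IsHomogeneous e) (h0 : p ≠ 0) : D ≤ e := by
  by_contra! hlt
  have key : ∀ q : MvPolynomial W K, homogeneousComponent e (q * p) = 0 := by
    refine Submodule.span_induction (p := fun x _ ↦ ∀ q : MvPolynomial W K,
      homogeneousComponent e (q * x) = 0) ?_ ?_ ?_ ?_ hp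
    · exact fun s hs q ↦ homogeneousComponent_mul_eq_zero hlt (hS s hs) q
    · simp
    · intro x y _ _ hx hy q
      rw [mul_add, map_add, hx, hy, add_zero]
    · intro r x _ hx q
      rw [smul_eq_mul, ← mul_assoc]
      exact hx _
  have := key 1
  rw [one_mul, homogeneousComponent_of_mem ((mem_homogeneousSubmodule _ _).2 he), if_pos rfl]
    at this
  exact h0 this

/-- Both variables would have to come from `g`, whose monomials have degree one. -/
theorem coeff_mul_eq_zero_of_supported {a b : W} (hab : a ≠ b) {g p : MvPolynomial W K}
    (hg : g.IsHomogeneous 1) (hp : p ∈ supported K ({a, b}ᶜ : Set W)) {m : W →₀ ℕ}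
    (ha : m a ≠ 0) (hb : m b ≠ 0) : coeff m (g * p) = 0 := by
  classical
  rw [coeff_mul]
  refine Finset.sum_eq_zero fun x hx ↦ ?_
  rw [Finset.HasAntidiagonal.mem_antidiagonal] at hx
  by_contra hne
  obtain ⟨h1, h2⟩ := ne_zero_and_ne_zero_of_mul hne
  have hz : ∀ w ∈ ({a, b} : Set W), x.2 w = 0 := by
    intro w hw
    by_contra hw0
    have : w ∈ p.vars := (mem_vars_iff_mem_support w).2 ⟨x.2, mem_support_iff.2 h2, Finsupp.mem_support_iff.2 hw0⟩
    exact mem_supported.1 hp this hw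
  have hxa : x.1 a ≠ 0 := by
    rw [← hx, Finsupp.add_apply, hz a (by simp)] at ha
    simpa using ha
  have hxb : x.1 b ≠ 0 := by
    rw [← hx, Finsupp.add_apply, hz b (by simp)] at hb
    simpa using hb
  have hdeg : x.1.degree = 1 := by
    rw [Finsupp.degree_eq_weight_one]
    exact hg h1
  have hle : ∑ w ∈ ({a, b} : Finset W), x.1 w ≤ x.1.degree := by
    rw [Finsupp.degree_apply]
    refine Finset.sum_le_sum_of_subset fun w hw ↦ ?_
    rw [Finset.mem_insert, Finset.mem_singleton] at hw
    rcases hw with rfl | rfl <;> simpa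
  rw [Finset.sum_pair hab] at hle
  omega

theorem eq_zero_of_X_mul_X_dvd {a b : W} {p : MvPolynomial W K}
    (hdvd : X a * X b ∣ p) (hp : ∀ m : W →₀ ℕ, m a ≠ 0 → m b ≠ 0 → coeff m p = 0) : p = 0 := by
  classical
  obtain ⟨q, rfl⟩ := hdvd
  suffices q = 0 by rw [this, mul_zero]
  ext m
  have h := hp (Finsupp.single a 1 + (Finsupp.single b 1 + m)) (by simp) (by simp)
  rwa [mul_assoc, coeff_X_mul, coeff_X_mul] at h

end Homogeneous

/-! ### The obstruction to linear relations -/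

section Obstruction

variable {K W : Type*} [Field K]

/-- The substitution `x_a = 0`. -/
noncomputable def killVariable (K : Type*) [Field K] {W : Type*} (a : W) :
    MvPolynomial W K →ₐ[K] MvPolynomial W K :=
  open Classical in aeval (fun w ↦ if w = a then 0 else X w)

theorem killVariable_X_self (a : W) : killVariable K a (X a) = 0 := by
  simp [killVariable]

theorem killVariable_eq_self {a : W} {s : Set W} (ha : a ∉ s) {p : MvPolynomial W K}
    (hp : p ∈ supported K s) : killVariable K a p = p := by
  rw [supported] at hp
  induction hp using Algebra.adjoin_induction with
  | mem x hx =>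
    obtain ⟨w, hw, rfl⟩ := hx
    have : w ≠ a := fun h ↦ ha (h ▸ hw)
    simp [killVariable, this]
  | algebraMap r => exact AlgHom.commutes _ r
  | add x y _ _ hx hy => rw [map_add, hx, hy]
  | mul x y _ _ hx hy => rw [map_mul, hx, hy]

theorem killVariable_eq_zero {a b : W} {p : MvPolynomial W K} (hp : X a * X b ∣ p) :
    killVariable K a p = 0 := by
  obtain ⟨q, rfl⟩ := hp
  rw [map_mul, map_mul, killVariable_X_self, zero_mul, zero_mul]

/-- An arbitrary minimal generating system may mix the two kinds of generators `K`-linearly; `x_a =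
0` extracts the part free of `x_a`, `x_b`. -/
theorem killVariable_of_mem_span {a b : W} {S : Set (MvPolynomial W K)}
    (hS : ∀ s ∈ S, X a * X b ∣ s ∨ s ∈ supported K ({a, b}ᶜ : Set W)) {p : MvPolynomial W K}
    (hp : p ∈ Submodule.span K S) :
    killVariable K a p ∈ supported K ({a, b}ᶜ : Set W) ∧ X a * X b ∣ p - killVariable K a p := by
  induction hp using Submodule.span_induction with
  | mem x hx =>
    rcases hS x hx with h | h
    · rw [killVariable_eq_zero h, sub_zero]
      exact ⟨zero_mem _, h⟩
    · rw [killVariable_eq_self (by simp) h, sub_self]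
      exact ⟨h, dvd_zero _⟩
  | zero => simp [zero_mem]
  | add x y _ _ hx hy =>
    rw [map_add, add_sub_add_comm]
    exact ⟨add_mem hx.1 hy.1, dvd_add hx.2 hy.2⟩
  | smul r x _ hx =>
    rw [map_smul, ← smul_sub]
    exact ⟨Subalgebra.smul_mem _ hx.1 r, smul_eq_C_mul (R := K) _ r ▸ hx.2.mul_left _⟩

/-- An ideal generated in degree `D` is not linearly related if its generators split into multiples
of `x_a x_b` and polynomials free of `x_a` and `x_b`, both kinds being present. -/
theorem not_isLinearlyRelated_span {a b : W} (hab : a ≠ b) {S : Set (MvPolynomial W K)} {D : ℕ}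
    (hD : ∀ s ∈ S, s.IsHomogeneous D)
    (hS : ∀ s ∈ S, X a * X b ∣ s ∨ s ∈ supported K ({a, b}ᶜ : Set W))
    {u v : MvPolynomial W K} (hu : u ∈ S) (hv : v ∈ S) (hu0 : u ≠ 0) (hv0 : v ≠ 0)
    (hdvd : X a * X b ∣ u) (hsupp : v ∈ supported K ({a, b}ᶜ : Set W)) :
    ¬ IsLinearlyRelated (Ideal.span S) := by
  rintro ⟨e, m, f, ⟨hhom, hspan, hmin⟩, hlin⟩
  have hfS : ∀ i, f i ∈ Ideal.span S := fun i ↦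
    hspan ▸ Ideal.subset_span (Set.mem_range_self i)
  have hSf : ∀ s ∈ S, s ∈ Ideal.span (Set.range f) := fun s hs ↦ hspan ▸ Ideal.subset_span hs
  have hf0 : ∀ i, f i ≠ 0 := fun i h ↦ hmin i (h ▸ zero_mem _)
  have hrange : ∀ p ∈ Set.range f, p.IsHomogeneous e := by
    rintro _ ⟨i, rfl⟩
    exact hhom i
  have heD : e = D := by
    refine le_antisymm (le_of_isHomogeneous_of_mem_span hrange (hSf u hu) (hD u hu) hu0) ?_
    rcases isEmpty_or_nonempty (Fin m) with hm | ⟨⟨i⟩⟩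
    · have := hSf u hu
      rw [Set.range_eq_empty, Ideal.span_empty, Ideal.mem_bot] at this
      exact absurd this hu0
    · exact le_of_isHomogeneous_of_mem_span hD (hfS i) (hhom i) (hf0 i)
  subst heD
  have hf : ∀ i, killVariable K a (f i) ∈ supported K ({a, b}ᶜ : Set W) ∧
      X a * X b ∣ f i - killVariable K a (f i) := fun i ↦
    killVariable_of_mem_span hS (mem_span_of_isHomogeneous hD (hfS i) (hhom i))
  -- Being a syzygy of the specialised family need only be checked on linear syzygies, which
  -- generate by assumption.
  have hker : syzygies f ≤
      LinearMap.ker (Fintype.linearCombination (MvPolynomial W K) (killVariable K a ∘ f)) := by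
    rw [← hlin, Submodule.span_le]
    rintro g ⟨hg, hg1⟩
    rw [syzygies, LinearMap.mem_ker, Fintype.linearCombination_apply] at hg
    rw [SetLike.mem_coe, LinearMap.mem_ker, Fintype.linearCombination_apply]
    simp only [smul_eq_mul, Function.comp_apply] at hg ⊢
    refine eq_zero_of_X_mul_X_dvd (a := a) (b := b) ?_ fun n ha hb ↦ ?_
    · have h : X a * X b ∣ ∑ i, g i * (f i - killVariable K a (f i)) :=
        Finset.dvd_sum fun i _ ↦ (hf i).2.mul_left _
      simpa [mul_sub, Finset.sum_sub_distrib, hg] using h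
    · rw [coeff_sum]
      exact Finset.sum_eq_zero fun i _ ↦ coeff_mul_eq_zero_of_supported hab (hg1 i) (hf i).1 ha hb
  obtain ⟨α, hα⟩ := (Submodule.mem_span_range_iff_exists_fun K).1
    (mem_span_of_isHomogeneous hrange (hSf u hu) (hD u hu))
  obtain ⟨β, hβ⟩ := (Submodule.mem_span_range_iff_exists_fun K).1
    (mem_span_of_isHomogeneous hrange (hSf v hv) (hD v hv))
  have hcomb : ∀ h : Fin m → MvPolynomial W K,
      ∑ i, (v * C (α i) - u * C (β i)) * h i = v * ∑ i, α i • h i - u * ∑ i, β i • h i := by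
    intro h
    simp only [sub_mul, Finset.sum_sub_distrib, Finset.mul_sum, smul_eq_C_mul, mul_assoc]
  -- The Koszul syzygy of `u` and `v`, written in the system `f`.
  have hsyz : (fun i ↦ v * C (α i) - u * C (β i)) ∈ syzygies f := by
    rw [syzygies, LinearMap.mem_ker, Fintype.linearCombination_apply]
    simp only [smul_eq_mul]
    rw [hcomb, hα, hβ, mul_comm, sub_self]
  have h := hker hsyz
  rw [LinearMap.mem_ker, Fintype.linearCombination_apply] at h
  simp only [smul_eq_mul] at h
  rw [hcomb] at h
  simp only [Function.comp_apply, ← map_smul, ← map_sum] at h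
  rw [hα, hβ, killVariable_eq_zero hdvd, killVariable_eq_self (by simp) hsupp, mul_zero, zero_sub,
    neg_eq_zero] at h
  exact mul_ne_zero hu0 hv0 h

end Obstruction

/-! ### Matchings of whiskered graphs -/

section Matching

variable {K : Type*} [Field K]

theorem edgeMonomial_mk {W : Type*} (x y : W) : edgeMonomial K s(x, y) = X x * X y := rfl

theorem matchingMonomial_isHomogeneous {W : Type*} (M : Finset (Sym2 W)) :
    (matchingMonomial K M).IsHomogeneous (M.card * 2) := by
  rw [Finset.card_eq_sum_ones, Finset.sum_mul]
  refine IsHomogeneous.prod _ _ _ fun e _ ↦ ?_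
  induction e using Sym2.ind with
  | _ x y => exact (isHomogeneous_X K x).mul (isHomogeneous_X K y)

theorem matchingMonomial_ne_zero {W : Type*} (M : Finset (Sym2 W)) :
    matchingMonomial K M ≠ 0 := by
  refine Finset.prod_ne_zero_iff.2 fun e _ ↦ ?_
  induction e using Sym2.ind with
  | _ x y => exact mul_ne_zero (X_ne_zero x) (X_ne_zero y)

theorem matchingMonomial_mem_supported {W : Type*} {M : Finset (Sym2 W)} {s : Set W}
    (h : ∀ e ∈ M, ∀ w ∈ e, w ∈ s) : matchingMonomial K M ∈ supported K s := by
  refine prod_mem fun e he ↦ ?_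
  have hs := h e he
  clear h he
  induction e using Sym2.ind with
  | _ x y =>
    rw [edgeMonomial_mk]
    exact mul_mem (X_mem_supported.2 (hs x (Sym2.mem_mk_left x y)))
      (X_mem_supported.2 (hs y (Sym2.mem_mk_right x y)))

theorem X_mul_X_dvd_matchingMonomial {W : Type*} {M : Finset (Sym2 W)} {a b : W}
    (h : s(a, b) ∈ M) : X a * X b ∣ matchingMonomial K M := by
  rw [← edgeMonomial_mk, matchingMonomial]
  exact Finset.dvd_prod_of_mem _ h

variable {V : Type*}

/-- The whisker at `v`. -/
def whisker (v : V) : Sym2 (V ⊕ V) := s(Sum.inl v, Sum.inr v)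

theorem eq_of_mem_whisker {v w : V} {x : V ⊕ V} (hv : x ∈ whisker v) (hw : x ∈ whisker w) :
    v = w := by
  simp only [whisker, Sym2.mem_iff] at hv hw
  rcases hv with rfl | rfl <;> simpa using hw

theorem whisker_injective : Function.Injective (whisker : V → Sym2 (V ⊕ V)) := fun v _ h ↦
  eq_of_mem_whisker (Sym2.mem_mk_left (Sum.inl v) (Sum.inr v))
    (h ▸ Sym2.mem_mk_left (Sum.inl v) (Sum.inr v))

theorem isKMatching_map_whisker (H : SimpleGraph V) (T : Finset V) :
    IsKMatching (whiskerGraph H) T.card (T.map ⟨whisker, whisker_injective⟩) := by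
  refine ⟨fun e he ↦ ?_, fun e he e' he' hne x hx hx' ↦ ?_, Finset.card_map _⟩
  · obtain ⟨v, _, rfl⟩ := Finset.mem_map.1 he
    exact (SimpleGraph.mem_edgeSet _).2 (rfl : v = v)
  · obtain ⟨v, _, rfl⟩ := Finset.mem_map.1 he
    obtain ⟨w, _, rfl⟩ := Finset.mem_map.1 he'
    exact hne (congrArg whisker (eq_of_mem_whisker hx hx'))

theorem eq_whisker_of_isolated {H : SimpleGraph V} {w : V} (hw : ∀ v, ¬ H.Adj w v)
    {e : Sym2 (V ⊕ V)} (he : e ∈ (whiskerGraph H).edgeSet) {x : V ⊕ V} (hx : x ∈ e)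
    (hxw : x ∈ ({Sum.inl w, Sum.inr w} : Set (V ⊕ V))) : e = whisker w := by
  obtain ⟨y, rfl⟩ := hx
  have hadj : (whiskerGraph H).Adj x y := he
  rcases hxw with rfl | rfl <;> rcases y with y | y
  · exact absurd hadj (hw y)
  · rw [show w = y from hadj, whisker]
  · rw [show w = y from hadj, whisker, Sym2.eq_swap]
  · exact hadj.elim

theorem not_isLinearlyRelated_squarefreePower_whiskerGraph [Fintype V] {H : SimpleGraph V} {w : V}
    (hw : ∀ v, ¬ H.Adj w v) {k : ℕ} (hk : 1 ≤ k) (hkV : k < Fintype.card V) :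
    ¬ IsLinearlyRelated (squarefreePower K (whiskerGraph H) k) := by
  classical
  obtain ⟨T, hwT, -, hT⟩ := Finset.exists_subsuperset_card_eq (Finset.subset_univ {w})
    (by simpa using hk) hkV.le
  -- Avoiding `w` leaves one vertex fewer, which is where `k < Fintype.card V` is needed.
  obtain ⟨U, hUw, hU⟩ := Finset.exists_subset_card_eq (s := Finset.univ.erase w) (n := k)
    (by rw [Finset.card_erase_of_mem (Finset.mem_univ w), Finset.card_univ]; omega)
  have hsupp : ∀ M : Finset (Sym2 (V ⊕ V)), (∀ e ∈ M, e ∈ (whiskerGraph H).edgeSet) →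
      whisker w ∉ M → matchingMonomial K M ∈
        supported K ({Sum.inl w, Sum.inr w}ᶜ : Set (V ⊕ V)) := fun M hM hwM ↦
    matchingMonomial_mem_supported fun e he x hx hxw ↦
      hwM (eq_whisker_of_isolated hw (hM e he) hx hxw ▸ he)
  have hMT := isKMatching_map_whisker H T
  have hMU := isKMatching_map_whisker H U
  rw [hT] at hMT
  rw [hU] at hMU
  refine not_isLinearlyRelated_span (a := Sum.inl w) (b := Sum.inr w) Sum.inl_ne_inr (D := k * 2)
    ?_ ?_ ⟨_, hMT, rfl⟩ ⟨_, hMU, rfl⟩ (matchingMonomial_ne_zero _) (matchingMonomial_ne_zero _)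
    (X_mul_X_dvd_matchingMonomial ?_) (hsupp _ hMU.1 ?_)
  · rintro _ ⟨M, hM, rfl⟩
    exact hM.2.2 ▸ matchingMonomial_isHomogeneous M
  · rintro _ ⟨M, hM, rfl⟩
    by_cases h : whisker w ∈ M
    · exact Or.inl (X_mul_X_dvd_matchingMonomial h)
    · exact Or.inr (hsupp M hM.1 h)
  · exact Finset.mem_map_of_mem ⟨whisker, whisker_injective⟩ (hwT (Finset.mem_singleton_self w))
  · intro h
    obtain ⟨v, hv, hvw⟩ := Finset.mem_map.1 h
    obtain rfl := whisker_injective hvw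
    exact Finset.notMem_erase v _ (hUw hv)

end Matching

end SquarefreePower

theorem corollary2p3 {K : Type*} [Field K] {V : Type*} (c d : ℕ) (hd : 1 ≤ d) (hdc : d < c)
    (H : SimpleGraph V)
    (hH : Nonempty
      (H ≃g ((⊤ : SimpleGraph (Fin (c - d))) ⊕g (⊥ : SimpleGraph (Fin d)))))
    (k : ℕ) (hk : 1 ≤ k) (hkc : k < c) :
    ¬ SquarefreePower.IsLinearlyRelated
      (SquarefreePower.squarefreePower K (SquarefreePower.whiskerGraph H) k) := by
  obtain ⟨φ⟩ := hH
  let _ : Fintype V := Fintype.ofEquiv _ φ.toEquiv.symm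
  have hcard : Fintype.card V = c := by
    rw [Fintype.card_congr φ.toEquiv, Fintype.card_sum, Fintype.card_fin, Fintype.card_fin]
    omega
  refine SquarefreePower.not_isLinearlyRelated_squarefreePower_whiskerGraph
    (w := φ.symm (Sum.inr ⟨0, hd⟩)) (fun v hv ↦ ?_) hk (hcard ▸ hkc)
  rw [← φ.map_adj_iff, RelIso.apply_symm_apply] at hv
  rcases hφ : φ v with x | x <;> simp [hφ] at hv
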